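/- Call a subset $X\subseteq\mathbb C^k$ ($k\ge 0$) a constructible curve if it is definable, with parameters from $\mathbb C$, in the field $\overline{\mathbb C}=(\mathbb C;+,\cdot)$ and has dimension at most $1$. Here dimension is the acl-dimension: if $X$ is defined by a formula $\Phi$ with a finite set of parameters $B\subseteq\mathbb C$, then $\dim X\le d$ means that in a saturated elementary extension of $\overline{\mathbb C}$ (equivalently, in every elementary extension) no tuple $(a_1,\dots,a_k)$ satisfying $\Phi$ has a subtuple $(a_{i_1},\dots,a_{i_{d+1}})$ with $a_{i_{j+1}}\notin\operatorname{acl}(B\cup\{a_{i_1},\dots,a_{i_j}\})$ for all $0\le j\le d$, where $\operatorname{acl}(D)$ is the union of the finite sets definable with parameters from $D$ (this does not depend on the choice of $\Phi$ and $B$). Let $\mathcal C(\overline{\mathbb C}_{\mathbb C})$ be the first-order structure with universe $\mathbb C$ and with a $k$-ary predicate for each constructible curve in $\mathbb C^k$, for all $k\in\mathbb N$, and let $\mathcal C_3(\overline{\mathbb C}_{\mathbb C})$ be the structure with universe $\mathbb C$ and with a $k$-ary predicate for each constructible curve in $\mathbb C^k$, for all $k\le 3$. **Proposition.** The structures $\mathcal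 C_3(\overline{\mathbb C}_{\mathbb C})$ and $\mathcal C(\overline{\mathbb C}_{\mathbb C})$ define the same sets: for every set $A\subseteq\mathbb C$ of parameters, every $k\ge 0$ and every $S\subseteq\mathbb C^k$, the set $S$ is definable by a first-order formula (quantifiers allowed) with parameters from $A$ in $\mathcal C_3(\overline{\mathbb C}_{\mathbb C})$ if and only if it is definable by a first-order formula with parameters from $A$ in $\mathcal C(\overline{\mathbb C}_{\mathbb C})$. -/

import Mathlib

open scoped FirstOrder

namespace CurveStructures

/-- The model-theoretic algebraic closure of `A` in the `L`-structure `M`: the union of all finite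
subsets of `M` that are definable with parameters from `A`. -/
def acl (L : FirstOrder.Language.{0, 0}) {M : Type} [L.Structure M] (A : Set M) : Set M :=
  {x | ∃ S : Set M, A.Definable₁ L S ∧ S.Finite ∧ x ∈ S}

/-- `X ⊆ M ^ k` is definable in `M` with parameters and its acl-dimension is at most `d`.

`X` is the solution set of a formula `φ` with (finitely many) parameters `b` from `M`. In no
elementary extension `N` of `M` is there a tuple `a` satisfying `φ` with a subtuple
`(a (i 0), …, a (i d))` of length `d + 1` none of whose entries is algebraic over `b` and the
preceding entries of the subtuple.

Quantifying over all elementary extensions is the same as using one saturated extension, since the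
type over `b` of a tuple in any `N` is realized in the saturated one, and the conditions depend only
on that type. -/
def DefinableDimLE (L : FirstOrder.Language.{0, 0}) {M : Type} [L.Structure M] {k : ℕ}
    (X : Set (Fin k → M)) (d : ℕ) : Prop :=
  ∃ (m : ℕ) (b : Fin m → M) (φ : L.Formula (Fin k ⊕ Fin m)),
    X = {x | φ.Realize (Sum.elim x b)} ∧
    ∀ (N : Type) [L.Structure N] (f : M ↪ₑ[L] N) (a : Fin k → N),
      φ.Realize (Sum.elim a (f ∘ b)) →
      ∀ i : Fin (d + 1) → Fin k, ∃ j : Fin (d + 1),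
        a (i j) ∈ acl L (Set.range (f ∘ b) ∪ {y | ∃ l : Fin (d + 1), l < j ∧ y = a (i l)})

/-- The field of complex numbers as a structure in the language of rings. -/
noncomputable instance complexRingStructure : FirstOrder.Ring.CompatibleRing ℂ :=
  FirstOrder.Ring.compatibleRingOfRing ℂ

/-- Constructible curves in `ℂ ^ k`: the subsets definable in the field `ℂ` with parameters from `ℂ`
and of dimension at most one. -/
def IsConstructibleCurve {k : ℕ} (X : Set (Fin k → ℂ)) : Prop :=
  DefinableDimLE FirstOrder.Language.ring X 1

/-- The relational language with one `k`-ary predicate for each constructible curve in `ℂ ^ k`,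
for all `k ≤ n`. -/
def curveLanguageUpTo (n : ℕ) : FirstOrder.Language.{0, 0} where
  Functions := fun _ => Empty
  Relations := fun k => {X : Set (Fin k → ℂ) // k ≤ n ∧ IsConstructibleCurve X}

/-- The relational language with one `k`-ary predicate for each constructible curve in `ℂ ^ k`,
for all `k`. -/
def curveLanguage : FirstOrder.Language.{0, 0} where
  Functions := fun _ => Empty
  Relations := fun k => {X : Set (Fin k → ℂ) // IsConstructibleCurve X}

/-- The structure `𝒞ₙ` on `ℂ`. -/
instance curveStructureUpTo (n : ℕ) : (curveLanguageUpTo n).Structure ℂ where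
  funMap := fun g => Empty.elim g
  RelMap := fun X x => x ∈ X.1

/-- The structure `𝒞` on `ℂ`. -/
instance curveStructure : curveLanguage.Structure ℂ where
  funMap := fun g => Empty.elim g
  RelMap := fun X x => x ∈ X.1

end CurveStructures

/-! It suffices to define every constructible curve `X` without parameters from curves in ℂ³. A
definable set is a curve exactly when any two coordinates satisfy a nonzero polynomial relation on
it (`IsConstructibleCurve.exists_eval_eq_zero`,
`isConstructibleCurve_of_forall_exists_eval_eq_zero`). For a prime ideal `I` containing the ideal of
`X`, the fraction field of ℂ[x]/I then has transcendence degree at most 1, so by the primitive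
element theorem it is generated by the images of two polynomials `g₁`, `g₂`. Hence (g₁, g₂) is
injective on the zeros of `I` off some {b = 0} with `b ∉ I` (`exists_generically_injective`), and
this part of `X` can be recovered from the curves {(g₁(x), g₂(x), xᵢ)} in ℂ³
(`definable_of_images_definable`). The locus b = 0 is left to Noetherian induction on `I`. -/

namespace CurveStructures

open FirstOrder FirstOrder.Language Set

variable {M : Type*}

/-! ### Transfer of definability between relational languages. -/

theorem exists_boundedFormula_iff {L L' : Language} [L.Structure M] [L'.Structure M]
    [L.IsRelational]
    (hR : ∀ (k : ℕ) (r : L.Relations k),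
      (∅ : Set M).Definable L' {x : Fin k → M | Structure.RelMap r x})
    {α : Type*} {n : ℕ} (φ : L.BoundedFormula α n) :
    ∃ ψ : L'.BoundedFormula α n, ∀ (v : α → M) (xs : Fin n → M),
      ψ.Realize v xs ↔ φ.Realize v xs := by
  have term (n : ℕ) (t : L.Term (α ⊕ Fin n)) : ∃ i, t = .var i := by
    cases t with
    | var i => exact ⟨i, rfl⟩
    | func f _ => exact isEmptyElim f
  induction φ with
  | falsum => exact ⟨⊥, by simp [BoundedFormula.Realize]⟩
  | equal t₁ t₂ =>
    obtain ⟨i, rfl⟩ := term _ t₁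
    obtain ⟨j, rfl⟩ := term _ t₂
    exact ⟨(Term.var i).bdEqual (Term.var j), by simp [BoundedFormula.Realize]⟩
  | rel r ts =>
    choose i hi using fun l => term _ (ts l)
    obtain ⟨ψ, hψ⟩ := Set.empty_definable_iff.1 (hR _ r)
    refine ⟨BoundedFormula.relabel (k := 0) i ψ, fun v xs => ?_⟩
    have h := Set.ext_iff.1 hψ (fun l => Sum.elim v xs (i l))
    refine BoundedFormula.realize_relabel.trans
      ((iff_of_eq (congrArg _ (Subsingleton.elim _ _))).trans (h.symm.trans (iff_of_eq ?_)))
    simp only [mem_ofPred_eq, BoundedFormula.Realize, hi, Term.realize_var]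
  | imp _ _ ih₁ ih₂ =>
    obtain ⟨ψ₁, h₁⟩ := ih₁
    obtain ⟨ψ₂, h₂⟩ := ih₂
    exact ⟨ψ₁.imp ψ₂, fun v xs => by simp [BoundedFormula.realize_imp, h₁, h₂]⟩
  | all _ ih =>
    obtain ⟨ψ, h⟩ := ih
    exact ⟨ψ.all, fun v xs => by simp [BoundedFormula.realize_all, h]⟩

theorem _root_.Set.Definable.of_relations_definable {L L' : Language} [L.Structure M]
    [L'.Structure M] [L.IsRelational]
    (hR : ∀ (k : ℕ) (r : L.Relations k),
      (∅ : Set M).Definable L' {x : Fin k → M | Structure.RelMap r x})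
    {A : Set M} {α : Type*} {S : Set (α → M)} (hS : A.Definable L S) : A.Definable L' S := by
  rw [definable_iff_exists_formula_sum] at hS ⊢
  obtain ⟨φ, rfl⟩ := hS
  obtain ⟨ψ, hψ⟩ := exists_boundedFormula_iff (L' := L') hR φ
  exact ⟨ψ, by ext v; exact (hψ _ _).symm⟩

instance : curveLanguage.IsRelational := fun _ => inferInstanceAs (IsEmpty Empty)
instance (n : ℕ) : (curveLanguageUpTo n).IsRelational := fun _ => inferInstanceAs (IsEmpty Empty)

theorem definable_curveLanguage_of_curveLanguageUpTo {n : ℕ} {A : Set ℂ} {α : Type*}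
    {S : Set (α → ℂ)} (hS : A.Definable (curveLanguageUpTo n) S) : A.Definable curveLanguage S := by
  refine hS.of_relations_definable fun k r => ?_
  rw [Set.empty_definable_iff]
  exact ⟨Relations.formula (L := curveLanguage) (⟨r.1, r.2.2⟩ : curveLanguage.Relations k)
    fun i => .var i, by ext x; simp; rfl⟩

theorem IsConstructibleCurve.definable_curveLanguageUpTo {n k : ℕ} {X : Set (Fin k → ℂ)}
    (hX : IsConstructibleCurve X) (hk : k ≤ n) : (∅ : Set ℂ).Definable (curveLanguageUpTo n) X := by
  rw [Set.empty_definable_iff]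
  exact ⟨Relations.formula (L := curveLanguageUpTo n) (⟨X, hk, hX⟩ :
    (curveLanguageUpTo n).Relations k) fun i => .var i,
    by ext x; simp; rfl⟩

/-! ### Model-theoretic algebraic closure and field automorphisms. -/

theorem exists_ringEquiv_apply_eq_add {F K : Type*} [Field F] [Field K] [IsAlgClosed K]
    [Algebra F K] {x : K} (hx : Transcendental F x) (c : F) :
    ∃ σ : K ≃+* K, (∀ a : F, σ (algebraMap F K a) = algebraMap F K a) ∧
      σ x = x + algebraMap F K c := by
  classical
  obtain ⟨t, hxt, ht⟩ := exists_isTranscendenceBasis_superset (R := F) (s := {x})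
    ((algebraicIndependent_singleton_iff (⟨x, rfl⟩ : ({x} : Set K))).2 hx)
  have hxt : x ∈ t := hxt rfl
  -- Replacing x by x + c in a transcendence basis gives another independent family generating the
  -- same polynomial algebra. The resulting automorphism extends to its algebraic closure `K`.
  let f : t → Polynomial F := fun i => if i.1 = x then .X + .C c else .X
  have hf (i : t) : Transcendental F (f i) := by
    have h := (Polynomial.transcendental_X F).aeval (f i)
      (by simp only [f]; split_ifs <;> simp) (by simp only [f]; split_ifs <;> simp)
    rwa [Polynomial.aeval_X_left_apply] at h
  have hw := ht.1.polynomial_aeval_of_transcendental hf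
  set w : t → K := fun i => Polynomial.aeval i.1 (f i) with hwdef
  have hwx : w ⟨x, hxt⟩ = x + algebraMap F K c := by simp [hwdef, f]
  have hr : Algebra.adjoin F (range w) = Algebra.adjoin F (range ((↑) : t → K)) := by
    apply le_antisymm <;> rw [Algebra.adjoin_le_iff] <;> rintro _ ⟨i, rfl⟩
    · exact Algebra.adjoin_mono (by simp) (Polynomial.aeval_mem_adjoin_singleton F i.1)
    · by_cases hi : i.1 = x
      · have := (Algebra.adjoin F (range w)).sub_mem (Algebra.subset_adjoin ⟨⟨x, hxt⟩, hwx⟩)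
          (Subalgebra.algebraMap_mem _ c)
        simpa [hi] using this
      · exact Algebra.subset_adjoin ⟨i, by simp [hwdef, f, hi]⟩
  let := IsAlgClosed.isAlgClosure_of_transcendence_basis _ ht
  let e : Algebra.adjoin F (range ((↑) : t → K)) ≃ₐ[F] Algebra.adjoin F (range ((↑) : t → K)) :=
    (ht.1.aevalEquiv.symm.trans hw.aevalEquiv).trans (Subalgebra.equivOfEq _ _ hr)
  let σ := IsAlgClosure.equivOfEquiv K K e.toRingEquiv
  have hσ (a) : σ (a : Algebra.adjoin F (range ((↑) : t → K))) = e a :=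
    IsAlgClosure.equivOfEquiv_algebraMap K K e.toRingEquiv a
  refine ⟨σ, fun a => ?_, ?_⟩
  · simpa using hσ (algebraMap F _ a)
  · have h : ht.1.aevalEquiv (.X ⟨x, hxt⟩) = ⟨x, Algebra.subset_adjoin ⟨⟨x, hxt⟩, rfl⟩⟩ := by
      ext; simp
    have := hσ ⟨x, Algebra.subset_adjoin ⟨⟨x, hxt⟩, rfl⟩⟩
    rw [this, ← h, ← hwx]
    simp [e]

theorem realize_comp_ringEquiv {K : Type*} [Field K] [FirstOrder.Ring.CompatibleRing K]
    (σ : K ≃+* K) {α : Type*} (φ : Language.ring.Formula α) (v : α → K) :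
    φ.Realize (σ ∘ v) ↔ φ.Realize v :=
  StrongHomClass.realize_formula (Ring.languageEquivEquivRingEquiv.symm σ) φ

/-- If x were transcendental, automorphisms fixing `D` would carry it to every x + n, and these are
infinitely many in characteristic 0. -/
theorem isAlgebraic_of_mem_acl {F K : Type} [Field F] [CharZero F] [Field K] [IsAlgClosed K]
    [Algebra F K] [FirstOrder.Ring.CompatibleRing K] {D : Set K}
    (hD : D ⊆ range (algebraMap F K)) {x : K} (hx : x ∈ acl Language.ring D) :
    IsAlgebraic F x := by
  obtain ⟨S, hS, hfin, hxS⟩ := hx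
  by_contra hx
  obtain ⟨φ, hφ⟩ := definable_iff_exists_formula_sum.1 hS
  have mem (y : K) : y ∈ S ↔ φ.Realize (Sum.elim (fun d : D => (d : K)) fun _ : Fin 1 => y) := by
    simpa using Set.ext_iff.1 hφ (fun _ : Fin 1 => y)
  have hmem (n : ℕ) : x + algebraMap F K n ∈ S := by
    obtain ⟨σ, hσF, hσx⟩ := exists_ringEquiv_apply_eq_add hx (n : F)
    rw [mem] at hxS ⊢
    rw [← realize_comp_ringEquiv σ] at hxS
    convert! hxS using 1
    funext i
    rcases i with d | i
    · obtain ⟨a, ha⟩ := hD d.2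
      simp [← ha, hσF]
    · simp [hσx]
  refine infinite_of_injective_forall_mem (fun m n h => ?_) hmem hfin
  simpa using (algebraMap F K).injective (add_left_cancel h)

/-! ### Polynomials as terms, and finiteness of their zero sets. -/

/-- The term is independent of `K` and `g`, so polynomial identities pass through elementary
embeddings and ultraproducts. -/
theorem exists_term_realize_eq_eval₂ {R ι : Type*} [CommRing R] (P : MvPolynomial ι R) :
    ∃ t : Language.ring.Term (R ⊕ ι), ∀ (K : Type) [CommRing K] [FirstOrder.Ring.CompatibleRing K]
      (g : R →+* K) (v : ι → K), t.realize (Sum.elim g v) = P.eval₂ g v := by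
  induction P using MvPolynomial.induction_on with
  | C a => exact ⟨.var (.inl a), by simp⟩
  | add p q hp hq =>
    obtain ⟨s, hs⟩ := hp
    obtain ⟨t, ht⟩ := hq
    exact ⟨s + t, by simp [hs, ht]⟩
  | mul_X p i hp =>
    obtain ⟨s, hs⟩ := hp
    exact ⟨s * .var (.inr i), by simp [hs]⟩

/-- An elementary embedding of rings as a ring homomorphism. -/
def ringHomOfElementaryEmbedding {R K : Type*} [CommRing R] [CommRing K]
    [FirstOrder.Ring.CompatibleRing R] [FirstOrder.Ring.CompatibleRing K]
    (f : R ↪ₑ[Language.ring] K) : R →+* K where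
  toFun := f
  map_zero' := by simpa using! f.map_fun Ring.zeroFunc ![]
  map_one' := by simpa using! f.map_fun Ring.oneFunc ![]
  map_add' x y := by simpa using! f.map_fun Ring.addFunc ![x, y]
  map_mul' x y := by simpa using! f.map_fun Ring.mulFunc ![x, y]

theorem finite_setOf_eval_eq_zero {K : Type*} [Field K] {q : MvPolynomial (Fin 1) K}
    (hq : q ≠ 0) : {s : Fin 1 → K | q.eval s = 0}.Finite := by
  set p := (MvPolynomial.finSuccEquiv K 0 q).map (MvPolynomial.eval ![]) with hp
  have hp0 : p ≠ 0 := by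
    rw [hp, Ne, Polynomial.map_eq_zero_iff fun a b h => ?_]
    · simpa using hq
    · rw [MvPolynomial.eq_C_of_isEmpty a, MvPolynomial.eq_C_of_isEmpty b] at h ⊢
      simpa using h
  refine ((Multiset.finite_toSet p.roots).image fun y => ![y]).subset fun s hs => ⟨s 0, ?_, ?_⟩
  · rw [mem_ofPred_eq, Polynomial.mem_roots hp0, Polynomial.IsRoot, hp,
      ← MvPolynomial.eval_eq_eval_mv_eval']
    rw [mem_ofPred_eq] at hs
    convert! hs
    funext i
    fin_cases i; rfl
  · funext i
    fin_cases i; rfl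

theorem finite_setOf_forall_eval_eq_zero {K : Type*} [Field K] [Infinite K]
    {P : MvPolynomial (Fin 2) K} (hP : P ≠ 0) :
    {s : Fin 1 → K | ∀ y, P.eval (Fin.cons y s) = 0}.Finite := by
  obtain ⟨n, hn⟩ : ∃ n, (MvPolynomial.finSuccEquiv K 1 P).coeff n ≠ 0 := by
    by_contra! h
    exact hP ((MvPolynomial.finSuccEquiv K 1).map_eq_zero_iff.1 (Polynomial.ext h))
  refine (finite_setOf_eval_eq_zero hn).subset fun s hs => ?_
  have : (MvPolynomial.finSuccEquiv K 1 P).map (MvPolynomial.eval s) = 0 :=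
    Polynomial.funext fun y => by rw [← MvPolynomial.eval_eq_eval_mv_eval', hs y]; simp
  simpa using congrArg (Polynomial.coeff · n) this

theorem finite_setOf_eval_cons_eq_zero {K : Type*} [Field K] {P : MvPolynomial (Fin 2) K}
    {s : Fin 1 → K} (hs : ∃ y, P.eval (Fin.cons y s) ≠ 0) :
    {y : K | P.eval (Fin.cons y s) = 0}.Finite := by
  have h0 : (MvPolynomial.finSuccEquiv K 1 P).map (MvPolynomial.eval s) ≠ 0 := by
    obtain ⟨y, hy⟩ := hs
    rw [MvPolynomial.eval_eq_eval_mv_eval'] at hy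
    intro h
    simp [h] at hy
  refine (Multiset.finite_toSet
    ((MvPolynomial.finSuccEquiv K 1 P).map (MvPolynomial.eval s)).roots).subset fun y hy => ?_
  rw [mem_ofPred_eq, MvPolynomial.eval_eq_eval_mv_eval'] at hy
  exact (Polynomial.mem_roots h0).2 hy

theorem definable_setOf_eval_eq_zero {K ι : Type*} [Field K] [FirstOrder.Ring.CompatibleRing K]
    (P : MvPolynomial ι K) {D : Set K} (hD : ∀ m, P.coeff m ∈ D) :
    D.Definable Language.ring {x : ι → K | P.eval x = 0} := by
  have := FirstOrder.Ring.mvPolynomial_zeroLocus_definable {P}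
  simp only [Finset.coe_singleton, MvPolynomial.zeroLocus_span, Finset.mem_singleton,
    iUnion_iUnion_eq_left, mem_singleton_iff, forall_eq] at this
  refine (this.mono ?_)
  rintro _ ⟨m, _, rfl⟩
  exact hD m

/-- Either P(·, u) vanishes identically, which happens for finitely many u, or v is one of the
finitely many roots of P(·, u). -/
theorem mem_acl_of_eval_eq_zero {K : Type} [Field K] [Infinite K]
    [FirstOrder.Ring.CompatibleRing K] {P : MvPolynomial (Fin 2) K} (hP : P ≠ 0) {D : Set K}
    (hD : ∀ m, P.coeff m ∈ D) {u v : K} (h : P.eval ![v, u] = 0) :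
    u ∈ acl Language.ring D ∨ v ∈ acl Language.ring (D ∪ {u}) := by
  have hZ := definable_setOf_eval_eq_zero P hD
  by_cases hu : ∀ y, P.eval (Fin.cons y ![u]) = 0
  · refine .inl ⟨{s | ∀ y, P.eval ![y, s] = 0}, ?_, ?_, hu⟩
    · have := (hZ.preimage_comp
        (fun i : Fin 2 => (![.inr 0, .inl 0] i : Fin 1 ⊕ Fin 1))).forall_of_finite
      refine (congrArg (D.Definable Language.ring) (ext fun x => ?_)).mp this
      simp only [mem_ofPred_eq, mem_preimage]
      have (y : Fin 1 → K) : (fun i : Fin 2 => Sum.elim x y (![.inr 0, .inl 0] i)) = ![y 0, x 0] := by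
        funext i; fin_cases i <;> rfl
      simp only [Function.comp_def, this]
      exact ⟨fun h y => h fun _ => y, fun h y => h _⟩
    · refine ((finite_setOf_forall_eval_eq_zero hP).image (· 0)).subset fun s hs => ⟨![s], hs, rfl⟩
  · refine .inr ⟨{y | P.eval ![y, u] = 0}, ?_, finite_setOf_eval_cons_eq_zero (by simpa using hu), h⟩
    have hF : (D ∪ {u}).DefinableMap Language.ring (fun x : Fin 1 → K => ![x 0, u]) := by
      intro i
      fin_cases i
      · exact DefinableFun.proj Language.ring
      · exact definableFun_const Language.ring _ (mem_union_right _ rfl)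
    exact (hZ.mono subset_union_left).preimage_map hF

/-! ### Dimension at most one as pairwise polynomial dependence of coordinates. -/

/-- The diagonal embedding into an ultrapower. -/
def diagonalEmbedding (L : Language) {M α : Type*} [L.Structure M] [Nonempty M]
    (U : Ultrafilter α) : M ↪ₑ[L] (U : Filter α).Product (fun _ => M) where
  toFun z := ((fun _ => z : α → M) : (U : Filter α).Product (fun _ => M))
  map_formula' n φ x := by
    refine (Ultraproduct.realize_formula_cast (u := U) φ (fun i _ => x i)).trans ?_
    simp

theorem not_algebraicIndependent_of_forall_mem_acl {K : Type} [Field K] [IsAlgClosed K]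
    [FirstOrder.Ring.CompatibleRing K] [Algebra ℂ K] {D : Set K}
    (hD : D ⊆ range (algebraMap ℂ K)) {u : Fin 2 → K}
    (h : ∃ j, u j ∈ acl Language.ring (D ∪ {y | ∃ l, l < j ∧ y = u l})) :
    ¬ AlgebraicIndependent ℂ u := by
  intro hu
  obtain ⟨j, hj⟩ := h
  set s : Set (Fin 2) := {l | l < j}
  have : CharZero K := charZero_of_injective_algebraMap (algebraMap ℂ K).injective
  refine hu.transcendental_adjoin (s := s) (i := j) (lt_irrefl j)
    (IntermediateField.isAlgebraic_adjoin_iff.1 (isAlgebraic_of_mem_acl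
      (F := IntermediateField.adjoin ℂ (u '' s)) (union_subset (fun x hx => ?_) ?_) hj))
  · obtain ⟨c, rfl⟩ := hD hx
    exact ⟨algebraMap ℂ _ c, rfl⟩
  · rintro _ ⟨l, hl, rfl⟩
    exact ⟨⟨u l, IntermediateField.subset_adjoin _ _ ⟨l, hl, rfl⟩⟩, rfl⟩

/-- Without such a relation the sets `S P` generate a proper filter, directed because `P * Q`
handles `P` and `Q` together. In an ultrapower along it the coordinate functions form a point of `X`
whose i-th and j-th entries are independent over ℂ. -/
theorem IsConstructibleCurve.exists_eval_eq_zero {k : ℕ} {X : Set (Fin k → ℂ)}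
    (hX : IsConstructibleCurve X) (i j : Fin k) :
    ∃ P : MvPolynomial (Fin 2) ℂ, P ≠ 0 ∧ ∀ x ∈ X, P.eval ![x i, x j] = 0 := by
  by_contra! h
  obtain ⟨m, b, φ, hXφ, hφ⟩ := hX
  let S (P : {P : MvPolynomial (Fin 2) ℂ // P ≠ 0}) : Set (Fin k → ℂ) :=
    {x | x ∈ X ∧ P.1.eval ![x i, x j] ≠ 0}
  have : (⨅ P, Filter.principal (S P)).NeBot := by
    have : Nonempty {P : MvPolynomial (Fin 2) ℂ // P ≠ 0} := ⟨⟨1, one_ne_zero⟩⟩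
    refine Filter.iInf_neBot_of_directed (fun P Q => ⟨⟨P.1 * Q.1, mul_ne_zero P.2 Q.2⟩, ?_, ?_⟩)
      fun P => ?_
    · simp +contextual [S]
    · simp +contextual [S]
    · simpa [Set.Nonempty, S] using h P.1 P.2
  let U := Ultrafilter.of (⨅ P, Filter.principal (S P))
  have hU P : S P ∈ U := (Ultrafilter.of_le _ |>.trans (iInf_le _ P)) (Filter.mem_principal_self _)
  let N := (U : Filter (Fin k → ℂ)).Product (fun _ => ℂ)
  let f : ℂ ↪ₑ[Language.ring] N := diagonalEmbedding Language.ring U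
  have : (Theory.ACF 0).Model N := (f.theory_model_iff _).1 inferInstance
  have := FirstOrder.Field.modelField_of_modelACF 0 N
  let := FirstOrder.Field.fieldOfModelField N
  let := FirstOrder.Field.compatibleRingOfModelField N
  have := FirstOrder.Field.isAlgClosed_of_model_ACF 0 N
  let := (ringHomOfElementaryEmbedding f).toAlgebra
  let a (l : Fin k) : N := ((fun x => x l : (Fin k → ℂ) → ℂ) : N)
  have ha : φ.Realize (Sum.elim a (f ∘ b)) := by
    have := (Ultraproduct.realize_formula_cast (u := U) φ
      (Sum.elim (fun l x => x l) (fun l _ => b l))).2 ?_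
    · convert! this using 1
      funext l
      cases l <;> rfl
    · filter_upwards [hU ⟨1, one_ne_zero⟩] with x hx
      have := hx.1
      rw [hXφ, mem_ofPred_eq] at this
      convert! this using 1
      funext l
      cases l <;> rfl
  refine not_algebraicIndependent_of_forall_mem_acl (D := range (f ∘ b)) ?_
    (hφ N f a ha ![i, j]) ?_
  · rintro _ ⟨l, rfl⟩
    exact ⟨b l, rfl⟩
  · rw [algebraicIndependent_iff]
    intro P hP
    by_contra hP0
    obtain ⟨t, ht⟩ := exists_term_realize_eq_eval₂ P
    have h := (Ultraproduct.realize_formula_cast (u := U) (t.equal 0)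
      (Sum.elim (fun z _ => z) (fun l x => x (![i, j] l)))).1 (by
        rw [Formula.realize_equal]
        refine Eq.trans (Eq.trans ?_ hP) (Ring.realize_zero (R := N) _).symm
        rw [MvPolynomial.aeval_def]
        refine Eq.trans ?_ (ht N (algebraMap ℂ N) fun l => a (![i, j] l))
        congr 1
        funext l
        cases l <;> rfl)
    obtain ⟨x, hx, hxS⟩ := (h.and (hU ⟨P, hP0⟩)).exists
    refine hxS.2 ?_
    rw [MvPolynomial.eval, MvPolynomial.coe_eval₂Hom, ← ht]
    rw [Formula.realize_equal, Ring.realize_zero] at hx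
    rw [← hx]
    congr 1
    funext l
    rcases l with l | l
    · rfl
    · fin_cases l <;> rfl

theorem isConstructibleCurve_of_forall_exists_eval_eq_zero {k : ℕ} {X : Set (Fin k → ℂ)}
    (hX : (univ : Set ℂ).Definable Language.ring X)
    (h : ∀ i j, ∃ P : MvPolynomial (Fin 2) ℂ, P ≠ 0 ∧ ∀ x ∈ X, P.eval ![x i, x j] = 0) :
    IsConstructibleCurve X := by
  classical
  obtain ⟨A, -, hA⟩ := definable_iff_finitely_definable.1 hX
  choose P hP0 hP using h
  -- The parameters must include every coefficient of every `P i j`; 0 accounts for monomials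
  -- outside the support.
  let B : Finset ℂ := insert 0 (A ∪ Finset.univ.biUnion fun i => Finset.univ.biUnion fun j =>
    (P i j).support.image (P i j).coeff)
  have hB i j m : (P i j).coeff m ∈ B := by
    by_cases hm : (P i j).coeff m = 0
    · simp [B, hm]
    · simp only [B, Finset.mem_insert, Finset.mem_union, Finset.mem_biUnion, Finset.mem_univ,
        true_and]
      exact .inr (.inr ⟨i, j, Finset.mem_image_of_mem _ (MvPolynomial.mem_support_iff.2 hm)⟩)
  have hXB : (B : Set ℂ).Definable Language.ring X :=
    hA.mono fun x hx => by simp [B, Finset.mem_coe.1 hx]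
  obtain ⟨φ, hφ⟩ := definable_iff_exists_formula_sum.1 hXB
  let e := B.equivFin
  let b (l : Fin B.card) : ℂ := e.symm l
  refine ⟨B.card, b, φ.relabel (Sum.elim (fun x => .inr (e x)) .inl), ?_, fun N _ f a ha i => ?_⟩
  · rw [hφ]
    ext x
    simp only [mem_ofPred_eq, Formula.realize_relabel]
    apply iff_of_eq
    congr 1
    funext l
    cases l <;> simp [b]
  have : (Theory.ACF 0).Model N := (f.theory_model_iff _).1 inferInstance
  have := FirstOrder.Field.modelField_of_modelACF 0 N
  let := FirstOrder.Field.fieldOfModelField N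
  let := FirstOrder.Field.compatibleRingOfModelField N
  have := FirstOrder.Field.isAlgClosed_of_model_ACF 0 N
  have : Infinite N := .of_injective f f.injective
  let g := ringHomOfElementaryEmbedding f
  -- The order is reversed because `mem_acl_of_eval_eq_zero` takes the earlier entry as the second
  -- variable.
  obtain ⟨t, ht⟩ := exists_term_realize_eq_eval₂ (P (i 1) (i 0))
  have hPN : (P (i 1) (i 0)).eval₂ g ![a (i 1), a (i 0)] = 0 := by
    let θ : Language.ring.Formula ℂ := Formula.iAlls (Fin k)
      ((φ.relabel (Sum.map (↑) id)).imp ((t.relabel (Sum.map id ![i 1, i 0])).equal 0))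
    have hθ : θ.Realize (id : ℂ → ℂ) := by
      simp only [θ, Formula.realize_iAlls, Formula.realize_imp, Formula.realize_relabel,
        Formula.realize_equal, Term.realize_relabel, Ring.realize_zero]
      intro x hx
      have hxX : x ∈ X := by
        rw [hφ, mem_ofPred_eq]
        convert! hx using 1
        funext l
        cases l <;> rfl
      rw [← hP (i 1) (i 0) x hxX, MvPolynomial.eval, MvPolynomial.coe_eval₂Hom, ← ht]
      congr 1
      funext l
      rcases l with l | l
      · rfl
      · fin_cases l <;> rfl
    rw [← f.map_formula] at hθ
    simp only [θ, Formula.realize_iAlls, Formula.realize_imp, Formula.realize_relabel,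
      Formula.realize_equal, Term.realize_relabel, Ring.realize_zero] at hθ
    rw [← ht, ← hθ a]
    · congr 1
      funext l
      rcases l with l | l
      · rfl
      · fin_cases l <;> rfl
    · rw [Formula.realize_relabel] at ha
      convert! ha using 1
      funext l
      cases l <;> simp [b]
  have hPN0 : (P (i 1) (i 0)).map g ≠ 0 := by
    exact fun h => hP0 _ _ (MvPolynomial.map_injective g g.injective (h.trans (map_zero _).symm))
  have hD m : ((P (i 1) (i 0)).map g).coeff m ∈ range (f ∘ b) := by
    rw [MvPolynomial.coeff_map]
    exact ⟨e ⟨_, hB _ _ m⟩, by simp [b]; rfl⟩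
  rcases mem_acl_of_eval_eq_zero hPN0 hD (by rwa [MvPolynomial.eval_map]) with h | h
  · refine ⟨0, ?_⟩
    simpa using h
  · refine ⟨1, ?_⟩
    have : {y | ∃ l : Fin (1 + 1), l < 1 ∧ y = a (i l)} = {a (i 0)} := by
      ext y
      simp
    rwa [this]

/-! ### Function fields of curves and generically injective plane maps. -/

open IntermediateField in
-- A primitive element confined to the subspace `A`; with `A` the range of `Q` it is the image of a
-- polynomial.
theorem exists_mem_forall_mem_adjoin_simple {k F K : Type*} [Field k] [Infinite k] [Field F]
    [Field K] [Algebra k F] [Algebra k K] [Algebra F K] [IsScalarTower k F K]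
    [FiniteDimensional F K] [Algebra.IsSeparable F K] (A : Submodule k K) (S : Finset K)
    (hS : ∀ a ∈ S, a ∈ A) : ∃ θ ∈ A, ∀ a ∈ S, a ∈ F⟮θ⟯ := by
  classical
  have := Field.finite_intermediateField_of_exists_primitive_element F K
    (Field.exists_primitive_element F K)
  induction S using Finset.induction_on with
  | empty => exact ⟨0, A.zero_mem, by simp⟩
  | insert a S _ ih =>
    obtain ⟨θ, hθ, h⟩ := ih fun b hb => hS b (Finset.mem_insert_of_mem hb)
    -- There are finitely many intermediate fields and infinitely many scalars. A field containing θ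
    -- + ca and θ + da with c ≠ d contains both a and θ.
    obtain ⟨c, d, hcd, heq⟩ := Finite.exists_ne_map_eq_of_infinite fun c : k => F⟮θ + c • a⟯
    have smul_mem (e : k) {z : K} (hz : z ∈ F⟮θ + c • a⟯) : e • z ∈ F⟮θ + c • a⟯ := by
      rw [← algebraMap_smul F e z]
      exact F⟮θ + c • a⟯.smul_mem hz
    have hc : θ + c • a ∈ F⟮θ + c • a⟯ := mem_adjoin_simple_self F _
    have hd : θ + d • a ∈ F⟮θ + c • a⟯ := heq ▸ mem_adjoin_simple_self F (θ + d • a)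
    have ha : a ∈ F⟮θ + c • a⟯ := by
      have := smul_mem (c - d)⁻¹ (sub_mem hc hd)
      rwa [add_sub_add_left_eq_sub, ← sub_smul, smul_smul, inv_mul_cancel₀ (sub_ne_zero.2 hcd),
        one_smul] at this
    have hθ' : θ ∈ F⟮θ + c • a⟯ := by simpa using sub_mem hc (smul_mem c ha)
    refine ⟨θ + c • a, A.add_mem hθ (A.smul_mem c (hS a (Finset.mem_insert_self a S))), ?_⟩
    intro b hb
    rcases Finset.mem_insert.1 hb with rfl | hb
    · exact ha
    · exact (adjoin_simple_le_iff.2 hθ') (h b hb)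

theorem isAlgebraic_adjoin_simple_of_aeval_eq_zero {k K : Type*} [Field k] [Field K] [Algebra k K]
    {u v : K} (hu : Transcendental k u) {P : MvPolynomial (Fin 2) k} (hP : P ≠ 0)
    (h : MvPolynomial.aeval ![u, v] P = 0) : IsAlgebraic (Algebra.adjoin k {u}) v := by
  by_contra hv
  refine hP ((?_ : AlgebraicIndependent k ![u, v]).eq_zero_of_aeval_eq_zero P h)
  have hc : ({1}ᶜ : Set (Fin 2)) = {0} := by ext i; fin_cases i <;> simp
  rw [AlgebraicIndependent.iff_transcendental_adjoin_image 1, hc]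
  have : Subsingleton {j : Fin 2 // j ≠ 1} := ⟨fun a b => Subtype.ext (by omega)⟩
  refine ⟨(algebraicIndependent_singleton_iff (⟨0, zero_ne_one⟩ : {j : Fin 2 // j ≠ 1})).2 hu, ?_⟩
  rw [image_singleton]
  exact hv

section

variable {k : ℕ} {K : Type*} [Field K] [Algebra ℂ K] {Q : MvPolynomial (Fin k) ℂ →ₐ[ℂ] K}

theorem adjoin_range_X_eq_top {F : Type*} [Field F] [Algebra ℂ F] [Algebra F K]
    [IsScalarTower ℂ F K] (hQ : ∀ z, ∃ a b, z = Q a / Q b) :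
    IntermediateField.adjoin F (range fun i => Q (.X i)) = ⊤ := by
  have h (p) : Q p ∈ IntermediateField.adjoin F (range fun i => Q (.X i)) := by
    induction p using MvPolynomial.induction_on with
    | C c =>
      rw [← MvPolynomial.algebraMap_eq, AlgHom.commutes, IsScalarTower.algebraMap_apply ℂ F K]
      exact IntermediateField.algebraMap_mem _ _
    | add p q hp hq => rw [map_add]; exact add_mem hp hq
    | mul_X p i hp =>
      rw [map_mul]
      exact mul_mem hp (IntermediateField.subset_adjoin _ _ ⟨i, rfl⟩)
  refine eq_top_iff.2 fun z _ => ?_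
  obtain ⟨a, b, rfl⟩ := hQ z
  exact div_mem (h a) (h b)

theorem exists_isAlgebraic_adjoin_simple (hQ : ∀ z, ∃ a b, z = Q a / Q b)
    (h : ∀ i j, ∃ P : MvPolynomial (Fin 2) ℂ, P ≠ 0 ∧
      MvPolynomial.aeval ![Q (.X i), Q (.X j)] P = 0) :
    ∃ t, Algebra.IsAlgebraic (IntermediateField.adjoin ℂ {Q t}) K := by
  suffices ∃ t, ∀ i, IsAlgebraic (IntermediateField.adjoin ℂ {Q t}) (Q (.X i)) by
    obtain ⟨t, ht⟩ := this
    refine ⟨t, ?_⟩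
    have := IntermediateField.isAlgebraic_adjoin (K := IntermediateField.adjoin ℂ {Q t})
      (S := range fun i => Q (.X i)) (by rintro _ ⟨i, rfl⟩; exact (ht i).isIntegral)
    rw [adjoin_range_X_eq_top hQ] at this
    exact (IntermediateField.topEquiv (F := IntermediateField.adjoin ℂ {Q t})
      (E := K)).isAlgebraic_iff.1 this
  by_cases hj : ∃ j, Transcendental ℂ (Q (.X j))
  · obtain ⟨j, hj⟩ := hj
    refine ⟨.X j, fun i => ?_⟩
    obtain ⟨P, hP0, hP⟩ := h j i
    exact IntermediateField.isAlgebraic_adjoin_iff.2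
      (isAlgebraic_adjoin_simple_of_aeval_eq_zero hj hP0 hP)
  -- With every coordinate algebraic over ℂ, any `t` would do.
  · simp only [Transcendental, not_exists, not_not] at hj
    exact ⟨0, fun i => (hj i).tower_top _⟩

theorem exists_aeval_eq_zero_of_isAlgebraic_adjoin_simple {t : K}
    [Algebra.IsAlgebraic (IntermediateField.adjoin ℂ {t}) K] (u : Fin 2 → K) :
    ∃ P : MvPolynomial (Fin 2) ℂ, P ≠ 0 ∧ MvPolynomial.aeval u P = 0 := by
  by_contra! h
  have hu : AlgebraicIndependent ℂ u := by
    rw [algebraicIndependent_iff]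
    intro P hP
    by_contra hP0
    exact h P hP0 hP
  have : Algebra.IsAlgebraic (Algebra.adjoin ℂ {t}) K :=
    IntermediateField.isAlgebraic_adjoin_iff_top.1 inferInstance
  have h1 := Algebra.IsAlgebraic.trdeg_le_cardinalMk ℂ ({t} : Set K)
  have h2 := hu.lift_cardinalMk_le_trdeg
  simp only [Cardinal.mk_fintype, Fintype.card_fin, Cardinal.lift_natCast, Cardinal.lift_id'] at h2
  have h3 := h2.trans h1
  simp at h3

theorem exists_mul_eq_of_isAlgebraic_adjoin_simple (hQ : ∀ z, ∃ a b, z = Q a / Q b)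
    {t : MvPolynomial (Fin k) ℂ} [Algebra.IsAlgebraic (IntermediateField.adjoin ℂ {Q t}) K] :
    ∃ θ, ∀ i, ∃ r ∈ Algebra.adjoin ℂ {t, θ}, ∃ s ∈ Algebra.adjoin ℂ {t, θ},
      Q s ≠ 0 ∧ Q (.X i * s) = Q r := by
  classical
  set F := IntermediateField.adjoin ℂ {Q t}
  have : FiniteDimensional F K := by
    have := IntermediateField.finiteDimensional_adjoin (K := F)
      (S := range fun i => Q (.X i)) fun z _ => Algebra.IsIntegral.isIntegral z
    rw [adjoin_range_X_eq_top hQ] at this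
    exact LinearEquiv.finiteDimensional (IntermediateField.topEquiv (F := F) (E := K)).toLinearEquiv
  obtain ⟨_, ⟨θ, rfl⟩, hθ⟩ := exists_mem_forall_mem_adjoin_simple (F := F)
    (LinearMap.range Q.toLinearMap) (Finset.univ.image fun i => Q (.X i)) (by simp)
  refine ⟨θ, fun i => ?_⟩
  have hi : Q (.X i) ∈ (IntermediateField.adjoin F {Q θ}).restrictScalars ℂ := hθ _ (by simp)
  rw [IntermediateField.adjoin_simple_adjoin_simple, IntermediateField.mem_adjoin_iff_div] at hi
  have himage : ({Q t, Q θ} : Set K) = Q '' {t, θ} := by simp [image_pair]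
  obtain ⟨_, hr, _, hs, hrs⟩ := hi
  rw [himage, ← AlgHom.map_adjoin] at hr hs
  obtain ⟨r, hr, rfl⟩ := hr
  obtain ⟨s, hs, rfl⟩ := hs
  by_cases h0 : Q s = 0
  -- Division by zero returns 0, so here Q(Xᵢ) = 0 and the fraction 0/1 serves.
  · exact ⟨0, zero_mem _, 1, one_mem _, by simp, by simpa [h0] using hrs⟩
  · exact ⟨r, hr, s, hs, h0, by rw [map_mul, hrs]; exact div_mul_cancel₀ _ h0⟩

end

/-- Each coordinate is a fraction rᵢ/sᵢ with rᵢ, sᵢ in ℂ[g₁, g₂], and `b` is the product of the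
denominators. -/
theorem exists_generically_injective {k : ℕ} (I : Ideal (MvPolynomial (Fin k) ℂ)) [I.IsPrime]
    (h : ∀ i j, ∃ P : MvPolynomial (Fin 2) ℂ, P ≠ 0 ∧
      MvPolynomial.aeval ![.X i, .X j] P ∈ I) :
    ∃ g₁ g₂ b : MvPolynomial (Fin k) ℂ, b ∉ I ∧
      (∀ x y : Fin k → ℂ, (∀ p ∈ I, p.eval x = 0) → (∀ p ∈ I, p.eval y = 0) →
        b.eval x ≠ 0 → b.eval y ≠ 0 → g₁.eval x = g₁.eval y → g₂.eval x = g₂.eval y → x = y) ∧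
      ∀ u : Fin 2 → MvPolynomial (Fin k) ℂ, ∃ P : MvPolynomial (Fin 2) ℂ, P ≠ 0 ∧
        MvPolynomial.aeval u P ∈ I := by
  let K := FractionRing (MvPolynomial (Fin k) ℂ ⧸ I)
  let Q : MvPolynomial (Fin k) ℂ →ₐ[ℂ] K :=
    (IsScalarTower.toAlgHom ℂ (MvPolynomial (Fin k) ℂ ⧸ I) K).comp (Ideal.Quotient.mkₐ ℂ I)
  have hQ0 (p) : Q p = 0 ↔ p ∈ I := by
    rw [← Ideal.Quotient.eq_zero_iff_mem]
    exact IsFractionRing.to_map_eq_zero_iff (R := MvPolynomial (Fin k) ℂ ⧸ I) (K := K)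
  have hQ (z : K) : ∃ a b, z = Q a / Q b := by
    obtain ⟨a, b, -, rfl⟩ := IsFractionRing.div_surjective (A := MvPolynomial (Fin k) ℂ ⧸ I) z
    obtain ⟨a, rfl⟩ := Ideal.Quotient.mk_surjective a
    obtain ⟨b, rfl⟩ := Ideal.Quotient.mk_surjective b
    exact ⟨a, b, rfl⟩
  have haeval (u : Fin 2 → MvPolynomial (Fin k) ℂ) (P : MvPolynomial (Fin 2) ℂ) :
      MvPolynomial.aeval u P ∈ I ↔ MvPolynomial.aeval (Q ∘ u) P = 0 := by
    rw [← hQ0, ← AlgHom.comp_apply, MvPolynomial.comp_aeval]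
    rfl
  obtain ⟨t, ht⟩ := exists_isAlgebraic_adjoin_simple hQ fun i j => by
    obtain ⟨P, hP0, hP⟩ := h i j
    refine ⟨P, hP0, ?_⟩
    rw [haeval] at hP
    convert! hP using 2
    ext l; fin_cases l <;> simp
  obtain ⟨θ, hθ⟩ := exists_mul_eq_of_isAlgebraic_adjoin_simple hQ (t := t)
  choose r hr s hs hs0 hrs using hθ
  refine ⟨t, θ, ∏ i, s i, ?_, fun x y hx hy hbx hby h₁ h₂ => ?_, fun u => ?_⟩
  · rw [← hQ0, map_prod]
    exact Finset.prod_ne_zero_iff.2 fun i _ => hs0 i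
  · rw [map_prod, Finset.prod_ne_zero_iff] at hbx hby
    -- Polynomials taking equal values at x and y form a subalgebra.
    have hadj : Algebra.adjoin ℂ {t, θ} ≤
        AlgHom.equalizer (MvPolynomial.aeval x) (MvPolynomial.aeval y) := by
      rw [Algebra.adjoin_le_iff]
      rintro _ (rfl | rfl)
      · simpa [MvPolynomial.aeval_eq_eval] using! h₁
      · simpa [MvPolynomial.aeval_eq_eval] using! h₂
    have hsi i : (s i).eval x = (s i).eval y := by
      simpa [MvPolynomial.aeval_eq_eval] using! hadj (hs i)
    have hri i : (r i).eval x = (r i).eval y := by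
      simpa [MvPolynomial.aeval_eq_eval] using! hadj (hr i)
    have hI i : .X i * s i - r i ∈ I := by rw [← hQ0, map_sub, hrs, sub_self]
    funext i
    have hxi := hx _ (hI i)
    have hyi := hy _ (hI i)
    rw [map_sub, map_mul, MvPolynomial.eval_X, sub_eq_zero] at hxi hyi
    rw [hsi, hri, ← hyi] at hxi
    exact mul_right_cancel₀ (hby i (Finset.mem_univ i)) hxi
  · obtain ⟨P, hP0, hP⟩ := exists_aeval_eq_zero_of_isAlgebraic_adjoin_simple (t := Q t) (Q ∘ u)
    exact ⟨P, hP0, (haeval u P).2 hP⟩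

/-! ### Reconstruction from ℂ³ and Noetherian induction. -/

theorem definable_setOf_forall_mem_ideal {ι : Type*} [Finite ι] (I : Ideal (MvPolynomial ι ℂ)) :
    (univ : Set ℂ).Definable Language.ring {x : ι → ℂ | ∀ p ∈ I, p.eval x = 0} := by
  obtain ⟨s, rfl⟩ := (isNoetherianRing_iff_ideal_fg _).1 inferInstance I
  have := definable_biInter_finset (fun p : MvPolynomial ι ℂ =>
    definable_setOf_eval_eq_zero p (D := univ) fun _ => mem_univ _) s
  refine (congrArg (Definable _ Language.ring) (ext fun x => ?_)).mp this
  simp only [mem_iInter, mem_ofPred_eq]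
  exact ⟨fun h p hp => (Ideal.span_le (I := RingHom.ker (MvPolynomial.eval x))).2 h hp,
    fun h p hp => h p (Ideal.subset_span hp)⟩

theorem definable_image_eval {ι κ : Type*} [Finite ι] [Finite κ] {Y : Set (ι → ℂ)}
    (hY : (univ : Set ℂ).Definable Language.ring Y) (u : κ → MvPolynomial ι ℂ) :
    (univ : Set ℂ).Definable Language.ring ((fun x l => (u l).eval x) '' Y) := by
  have h (l : κ) : (univ : Set ℂ).Definable Language.ring {z : κ ⊕ ι → ℂ |
      (MvPolynomial.X (Sum.inl l) - MvPolynomial.rename Sum.inr (u l)).eval z = 0} :=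
    definable_setOf_eval_eq_zero _ fun _ => mem_univ _
  refine (congrArg (Definable _ Language.ring) (ext fun z => ?_)).mp
    ((definable_iInter_of_finite h).inter (hY.preimage_comp Sum.inr)).exists_of_finite
  simp only [mem_ofPred_eq, mem_inter_iff, mem_iInter, map_sub, MvPolynomial.eval_X,
    MvPolynomial.eval_rename, Sum.elim_inl, Sum.elim_comp_inr, mem_preimage, sub_eq_zero,
    mem_image, funext_iff]
  exact exists_congr fun x => by simp only [eq_comm, and_comm]

/-- x lies in `Y` iff one pair v has (v₀, v₁, xᵢ) in the i-th image for every i: injectivity merges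
the k witnesses into one point, which is x. For k = 0 there would be no witness. -/
theorem definable_of_images_definable {L : Language} [L.Structure ℂ] {k : ℕ} (hk : 0 < k)
    {Y : Set (Fin k → ℂ)} {g₁ g₂ : (Fin k → ℂ) → ℂ}
    (hinj : ∀ x ∈ Y, ∀ y ∈ Y, g₁ x = g₁ y → g₂ x = g₂ y → x = y)
    (h : ∀ i, (∅ : Set ℂ).Definable L ((fun x => ![g₁ x, g₂ x, x i]) '' Y)) :
    (∅ : Set ℂ).Definable L Y := by
  have := (definable_iInter_of_finite fun i => (h i).preimage_comp
    (![.inr 0, .inr 1, .inl i] : Fin 3 → Fin k ⊕ Fin 2)).exists_of_finite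
  refine (congrArg (Definable _ L) (ext fun x => ?_)).mp this
  have hcomp (v : Fin 2 → ℂ) (i : Fin k) :
      Sum.elim x v ∘ (![.inr 0, .inr 1, .inl i] : Fin 3 → Fin k ⊕ Fin 2) = ![v 0, v 1, x i] := by
    funext l; fin_cases l <;> rfl
  simp only [mem_ofPred_eq, mem_iInter, mem_preimage, hcomp, mem_image]
  refine ⟨fun ⟨v, hv⟩ => ?_, fun hx => ⟨![g₁ x, g₂ x], fun i => ⟨x, hx, rfl⟩⟩⟩
  choose y hyY hy using hv
  have h0 i : g₁ (y i) = v 0 := congrFun (hy i) 0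
  have h1 i : g₂ (y i) = v 1 := congrFun (hy i) 1
  have h2 i : y i i = x i := congrFun (hy i) 2
  have : y ⟨0, hk⟩ = x := by
    funext i
    rw [hinj _ (hyY ⟨0, hk⟩) _ (hyY i) ((h0 _).trans (h0 i).symm) ((h1 _).trans (h1 i).symm), h2]
  exact this ▸ hyY _

theorem IsConstructibleCurve.definable_univ {k : ℕ} {X : Set (Fin k → ℂ)}
    (hX : IsConstructibleCurve X) : (univ : Set ℂ).Definable Language.ring X := by
  obtain ⟨m, b, φ, rfl, -⟩ := hX
  rw [definable_iff_exists_formula_sum]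
  refine ⟨φ.relabel (Sum.elim .inr fun l => .inl ⟨b l, mem_univ _⟩), ?_⟩
  ext x
  simp only [mem_ofPred_eq, Formula.realize_relabel]
  apply iff_of_eq
  congr 1
  funext l
  cases l <;> rfl

theorem IsConstructibleCurve.definable_inter_zeroLocus {k : ℕ} (hk : 0 < k) {X : Set (Fin k → ℂ)}
    (hX : IsConstructibleCurve X) (I : Ideal (MvPolynomial (Fin k) ℂ))
    (hI : ∀ p, (∀ x ∈ X, p.eval x = 0) → p ∈ I) :
    (∅ : Set ℂ).Definable (curveLanguageUpTo 3) (X ∩ {x | ∀ p ∈ I, p.eval x = 0}) := by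
  induction I using IsNoetherian.induction with
  | hgt I ih =>
  -- Adding an element outside `I` enlarges the ideal strictly, so the induction hypothesis covers
  -- the smaller zero set.
  have hsup (b) (hb : b ∉ I) : (∅ : Set ℂ).Definable (curveLanguageUpTo 3)
      (X ∩ {x | (∀ p ∈ I, p.eval x = 0) ∧ b.eval x = 0}) := by
    have hlt : I < I ⊔ Ideal.span {b} := left_lt_sup.2 fun h =>
      hb (h (Ideal.mem_span_singleton_self b))
    refine (congrArg (Definable _ _) (ext fun x => and_congr_right fun _ => ?_)).mp
      (ih _ hlt fun p hp => hlt.le (hI p hp))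
    have h (J : Ideal (MvPolynomial (Fin k) ℂ)) :
        (∀ p ∈ J, p.eval x = 0) ↔ J ≤ RingHom.ker (MvPolynomial.eval x) := Iff.rfl
    simp only [mem_ofPred_eq]
    rw [h, h, sup_le_iff, Ideal.span_singleton_le_iff_mem, RingHom.mem_ker]
  by_cases htop : I = ⊤
  · refine (congrArg (Definable _ _) (Eq.symm ?_)).mp definable_empty
    ext x
    simp only [mem_inter_iff, mem_ofPred_eq, mem_empty_iff_false, iff_false, not_and]
    exact fun _ h => one_ne_zero ((map_one _).symm.trans (h 1 (htop ▸ Submodule.mem_top)))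
  by_cases hprime : Ideal.IsPrime I
  · obtain ⟨g₁, g₂, b, hb, hinj, hdep⟩ := exists_generically_injective I fun i j => by
      obtain ⟨P, hP0, hP⟩ := hX.exists_eval_eq_zero i j
      refine ⟨P, hP0, hI _ fun x hx => ?_⟩
      rw [← hP x hx, ← MvPolynomial.aeval_eq_eval, ← AlgHom.comp_apply, MvPolynomial.comp_aeval,
        MvPolynomial.aeval_eq_eval]
      congr 2
      funext l
      fin_cases l <;> simp
    set Y := (X ∩ {x | ∀ p ∈ I, p.eval x = 0}) \ {x | b.eval x = 0} with hYdef
    have hYring : (univ : Set ℂ).Definable Language.ring Y :=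
      (hX.definable_univ.inter (definable_setOf_forall_mem_ideal I)).sdiff
        (definable_setOf_eval_eq_zero b fun _ => mem_univ _)
    have hY : (∅ : Set ℂ).Definable (curveLanguageUpTo 3) Y := by
      refine definable_of_images_definable hk (g₁ := fun x => g₁.eval x) (g₂ := fun x => g₂.eval x)
        (fun x hx y hy => hinj x y hx.1.2 hy.1.2 hx.2 hy.2) fun l => ?_
      refine IsConstructibleCurve.definable_curveLanguageUpTo ?_ le_rfl
      have himage : (fun x : Fin k → ℂ => ![g₁.eval x, g₂.eval x, x l]) =
          fun x i => (![g₁, g₂, .X l] i).eval x := by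
        funext x i
        fin_cases i <;> simp
      rw [himage]
      refine isConstructibleCurve_of_forall_exists_eval_eq_zero (definable_image_eval hYring _)
        fun i j => ?_
      obtain ⟨P, hP0, hP⟩ := hdep ![![g₁, g₂, .X l] i, ![g₁, g₂, .X l] j]
      refine ⟨P, hP0, ?_⟩
      rintro _ ⟨x, hx, rfl⟩
      have := hx.1.2 _ hP
      rw [← this, ← MvPolynomial.aeval_eq_eval x, ← AlgHom.comp_apply, MvPolynomial.comp_aeval,
        MvPolynomial.aeval_eq_eval]
      congr 2
      funext l
      fin_cases l <;> rfl
    refine (congrArg (Definable _ _) (ext fun x => ?_)).mp (hY.union (hsup b hb))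
    simp only [hYdef, mem_union, mem_sdiff, mem_inter_iff, mem_ofPred_eq]
    tauto
  -- With ab in `I`, the zero set splits into its parts where a = 0 and where b = 0.
  · obtain ⟨a, ha, b, hb, hab⟩ := (Ideal.not_isPrime_iff.1 hprime).resolve_left htop
    refine (congrArg (Definable _ _) (ext fun x => ?_)).mp ((hsup a ha).union (hsup b hb))
    simp only [mem_union, mem_inter_iff, mem_ofPred_eq]
    have (h : ∀ p ∈ I, p.eval x = 0) : a.eval x = 0 ∨ b.eval x = 0 := by
      simpa using h _ hab
    tauto

theorem IsConstructibleCurve.definable_curveLanguageUpTo_three {k : ℕ} {X : Set (Fin k → ℂ)}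
    (hX : IsConstructibleCurve X) : (∅ : Set ℂ).Definable (curveLanguageUpTo 3) X := by
  rcases k.eq_zero_or_pos with rfl | hk
  · exact hX.definable_curveLanguageUpTo (Nat.zero_le 3)
  · refine (congrArg (Definable _ _) (inter_eq_left.2 fun x hx p hp => ?_)).mp
      -- The induction is applied to the full vanishing ideal of `X`, whose zero set contains `X`.
      (hX.definable_inter_zeroLocus hk (⨅ x ∈ X, RingHom.ker (MvPolynomial.eval x)) ?_)
    · simp only [Ideal.mem_iInf, RingHom.mem_ker] at hp
      exact hp x hx
    · simp

end CurveStructures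

theorem proposition6p1 :
    ∀ (A : Set ℂ) (k : ℕ) (S : Set (Fin k → ℂ)),
      A.Definable (CurveStructures.curveLanguageUpTo 3) S ↔
        A.Definable CurveStructures.curveLanguage S :=
  fun _ _ _ => ⟨CurveStructures.definable_curveLanguage_of_curveLanguageUpTo, fun h =>
    h.of_relations_definable (L := CurveStructures.curveLanguage) fun _ r =>
      r.2.definable_curveLanguageUpTo_three⟩
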